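/- Let $S$ be a monoid. A (left) $S$-polygon is a nonempty set $A$ with a left action of $S$ (so $1a=a$ and $s(ta)=(st)a$), regarded as a structure of the first-order language with one unary function symbol for each $s\in S$. For $a\in A$ put $Sa=\{sa: s\in S\}$. The polygon $A$ is regular if for every $a\in A$ there is a homomorphism of polygons $\varphi:Sa\to S$ with $\varphi(a)a=a$. Let $\mathfrak R$ be the class of all regular $S$-polygons, and let $R$ (the regular core of $S$) be the union of all regular subpolygons of $S$, regarded as a polygon over itself; $R$ is a subsemigroup of $S$. Assume $R\neq\emptyset$. The class $\mathfrak R$ is called axiomatizable if it is the class of all models of some set of first-order sentences. It is called complete (model complete) if its elementary theory, the set of all sentences true in all regular $S$-polygons, is complete (model complete); here a theory is model complete if it is consistent and for any two of its models $A\subseteq B$ the model $A$ is an elementary substructure of $B$. The class $\mathfrak R$ satisfies the condition of formula definability of isomorphic orbits if for each idempotent $e\in R$ there is a first-order formula $\Phi_e(x)$ such that, for every regular $S$-polygon $A$ and every $a\in A$, $A\models\Phi_e(a)$ if and only if there is an isomorphism of polygons $Sa\to Se$ taking $a$ to $e$. A semigroup $T$ is a rectangular band of groups if it is the disjoint union of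 subsets $T_{ij}$ $(i\in I(T),\ j\in J(T))$, each of which is a group under the operation of $T$, such that $T_{ij}T_{kl}\subseteq T_{il}$ for all $i,k\in I(T)$ and $j,l\in J(T)$. Theorem 6.1. The following conditions are equivalent: (1) the class $\mathfrak R$ is axiomatizable, model complete and satisfies the condition of formula definability of isomorphic orbits; (2) the class $\mathfrak R$ is axiomatizable, complete and satisfies the condition of formula definability of isomorphic orbits; (3) the semigroup $R$ is a rectangular band of infinite groups $R_{ij}$ $(i\in I(R),\ j\in J(R))$ with $I(R)$ finite. -/

import Mathlib

open FirstOrder CategoryTheory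

universe u v

namespace RegularPolygons

/-! ### Polygons (left acts over a monoid) as first-order structures -/

/-- The function symbols of the language of left `S`-polygons: one unary symbol for each `s : S`. -/
inductive PolygonFunctions (S : Type u) : ℕ → Type u
  | act (s : S) : PolygonFunctions S 1

/-- The language of left `S`-polygons. -/
def polygonLanguage (S : Type u) : FirstOrder.Language.{u, 0} where
  Functions := PolygonFunctions S
  Relations := fun _ => Empty

/-- A left `S`-polygon, that is, a set with a left action of the monoid `S`, as a structure of the
language of `S`-polygons. -/
instance polygonStructure (S : Type u) [Monoid S] (A : Type v) [MulAction S A] :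
    (polygonLanguage S).Structure A where
  funMap := fun {_} f =>
    match f with
    | PolygonFunctions.act s => fun x => s • x 0
  RelMap := fun {_} r => r.elim

/-! ### Regular polygons and the regular core -/

/-- `a` is act-regular: there is a homomorphism of polygons `φ : Sa → S` with `φ(a) a = a`.
Here `MulAction.orbit S a` is `Sa = {s • a | s ∈ S}`. -/
def IsActRegular (S : Type u) [Monoid S] {A : Type v} [MulAction S A] (a : A) : Prop :=
  ∃ φ : MulAction.orbit S a →[S] S, φ ⟨a, MulAction.mem_orbit_self a⟩ • a = a

/-- A polygon is regular if all its elements are act-regular. -/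
def IsRegularPolygon (S : Type u) [Monoid S] (A : Type v) [MulAction S A] : Prop :=
  ∀ a : A, IsActRegular S a

/-- The regular core `R` of the monoid `S`: the union of all regular subpolygons of the polygon `S`
over itself. It is a left ideal, in particular a subsemigroup, of `S`. -/
def regularCore (S : Type u) [Monoid S] : Subsemigroup S where
  carrier := {a | ∃ B : SubMulAction S S, IsRegularPolygon S B ∧ a ∈ B}
  mul_mem' := by
    rintro a b - ⟨B, hB, hb⟩
    exact ⟨B, hB, B.smul_mem a hb⟩

/-- There is an isomorphism of polygons `Sa → Sb` which takes `a` to `b`. -/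
def IsomorphicOrbits (S : Type u) [Monoid S] {A : Type*} [MulAction S A] {B : Type*} [MulAction S B]
    (a : A) (b : B) : Prop :=
  ∃ f : MulAction.orbit S a →[S] MulAction.orbit S b, Function.Bijective f ∧
    f ⟨a, MulAction.mem_orbit_self a⟩ = ⟨b, MulAction.mem_orbit_self b⟩

/-- The class of all regular `S`-polygons (as always in model theory, structures are nonempty):
the structures whose operations come from an action of `S` for which the polygon is regular. -/
def regularPolygons (S : Type u) [Monoid S] : Set (Bundled.{u} (polygonLanguage S).Structure) :=
  {M | Nonempty M ∧ ∃ _ : MulAction S M, M.str = polygonStructure S M ∧ IsRegularPolygon S M}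

/-! ### Classes of structures -/

section Classes

variable {L : FirstOrder.Language.{u, 0}}

/-- A class of structures is axiomatizable if it is the class of all models of a set of
sentences. -/
def IsAxiomatizable (K : Set (Bundled.{u} L.Structure)) : Prop :=
  ∃ Z : L.Theory, ∀ M : Bundled.{u} L.Structure, Nonempty M → (M ∈ K ↔ M ⊨ Z)

/-- The elementary theory of a class of structures: the set of all sentences true in all of them. -/
def classTheory (K : Set (Bundled.{u} L.Structure)) : L.Theory :=
  {φ | ∀ M ∈ K, M ⊨ φ}

/-- A theory is model complete if it is consistent and, for all models `M` of it, every
substructure of `M` which is also a model is an elementary substructure. -/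
def IsModelCompleteTheory (T : L.Theory) : Prop :=
  T.IsSatisfiable ∧
    ∀ (M : Type u) [L.Structure M] [Nonempty M], M ⊨ T →
      ∀ N : L.Substructure M, Nonempty N → N ⊨ T → N.IsElementary

/-- A class of structures is complete if its elementary theory is complete. -/
def IsCompleteClass (K : Set (Bundled.{u} L.Structure)) : Prop :=
  (classTheory K).IsComplete

/-- A class of structures is model complete if its elementary theory is model complete. -/
def IsModelCompleteClass (K : Set (Bundled.{u} L.Structure)) : Prop :=
  IsModelCompleteTheory (classTheory K)

end Classes

/-- The condition of formula definability of isomorphic orbits for the class of regular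
`S`-polygons: for each idempotent `e` of the regular core there is a first-order formula `Φ` in one
free variable which in every regular polygon defines the set of those `a` for which there is an
isomorphism `Sa → Se` taking `a` to `e`. -/
def HasFormulaDefinableIsomorphicOrbits (S : Type u) [Monoid S] : Prop :=
  ∀ e ∈ regularCore S, IsIdempotentElem e →
    ∃ Φ : (polygonLanguage S).Formula (Fin 1),
      ∀ (A : Type u) [MulAction S A], IsRegularPolygon S A →
        ∀ a : A, Φ.Realize ![a] ↔ IsomorphicOrbits S a e

/-! ### Rectangular bands of groups -/

/-- A subset of a semigroup which is a group under the operation of the semigroup. -/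
def IsGroupSubset {T : Type u} [Semigroup T] (H : Set T) : Prop :=
  (∀ x ∈ H, ∀ y ∈ H, x * y ∈ H) ∧
    ∃ e ∈ H, (∀ x ∈ H, e * x = x ∧ x * e = x) ∧ ∀ x ∈ H, ∃ y ∈ H, x * y = e ∧ y * x = e

/-- A presentation of the semigroup `T` as a rectangular band of groups: a decomposition
(partition) of `T` into groups `T_{ij}`, `i ∈ I`, `j ∈ J`, with `T_{ij} T_{kl} ⊆ T_{il}`. -/
structure RectangularBandOfGroups (T : Type u) [Semigroup T] where
  /-- The first index set, `I(T)`. -/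
  I : Type u
  /-- The second index set, `J(T)`. -/
  J : Type u
  /-- The groups `T_{ij}`. -/
  component : I → J → Set T
  exists_mem : ∀ x : T, ∃ i j, x ∈ component i j
  eq_of_mem : ∀ {x : T} {i k : I} {j l : J}, x ∈ component i j → x ∈ component k l → i = k ∧ j = l
  isGroupSubset : ∀ i j, IsGroupSubset (component i j)
  mul_mem : ∀ {x y : T} {i k : I} {j l : J},
    x ∈ component i j → y ∈ component k l → x * y ∈ component i l

end RegularPolygons

-- An element `a` of a polygon is governed by its annihilator, the left congruence of the pairs `(s,
-- t)` with `sa = ta`. Pointed orbits are isomorphic exactly when their annihilators agree, and a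
-- polygon is regular exactly when each annihilator is that of an idempotent of `R`. Condition (3)
-- amounts to three facts: the left ideals `Sa`, `a ∈ R`, are minimal, they are infinite, and only
-- finitely many annihilators occur in `R`. The rows of the band are then the annihilators and its
-- columns the left ideals `Sa`.
--
-- Model completeness gives completeness because any two regular polygons embed in their disjoint
-- sum, which is regular.
--
-- From (2), an ultraproduct bounds the number of annihilators (`finite_leftAnn_of_axiomatizable`).
-- Comparing `Sa` with two disjoint copies of itself shows that it is infinite. Minimality
-- (`hasMinimalCore_of_complete`) comes from comparing `Se` with the regular part of a large cofree
-- polygon, where certain equations `s g = f` are always solvable.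
--
-- From (3), minimality makes the equation `e x = x` define the elements with the annihilator of `e`
-- (`HasMinimalCore.leftAnn_eq`), so finitely many idempotents suffice to axiomatize regularity.
-- Moreover every orbit of a regular polygon is a copy of one fixed `Se`. Extensions of `A` of the
-- same large cardinality are therefore isomorphic over `A`, and together with upward
-- Löwenheim–Skolem this yields model completeness.

universe w

namespace RegularPolygons

/-! ### Annihilators, pointed orbits and regularity -/

section Annihilators

variable {S : Type u} [Monoid S] {A : Type v} [MulAction S A] {B : Type w} [MulAction S B]

/-- The left congruence of `S` which consists of the pairs acting in the same way on `a`. It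
determines the pointed orbit `Sa` up to isomorphism. -/
def leftAnn (S : Type u) [Monoid S] {A : Type v} [MulAction S A] (a : A) : Set (S × S) :=
  {p | p.1 • a = p.2 • a}

theorem mem_leftAnn {a : A} {s t : S} : (s, t) ∈ leftAnn S a ↔ s • a = t • a := Iff.rfl

theorem leftAnn_eq_iff {a : A} {b : B} :
    leftAnn S a = leftAnn S b ↔ ∀ s t : S, s • a = t • a ↔ s • b = t • b := by
  constructor
  · intro h s t
    rw [← mem_leftAnn, h, mem_leftAnn]
  · intro h
    ext ⟨s, t⟩
    exact h s t

theorem leftAnn_smul_congr {a : A} {b : B} (h : leftAnn S a = leftAnn S b) (s : S) :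
    leftAnn S (s • a) = leftAnn S (s • b) := by
  rw [leftAnn_eq_iff] at h ⊢
  intro p q
  simp only [smul_smul]
  exact h _ _

theorem leftAnn_of_injective {f : A → B} (hf : Function.Injective f)
    (hs : ∀ (s : S) a, f (s • a) = s • f a) (a : A) : leftAnn S (f a) = leftAnn S a := by
  rw [leftAnn_eq_iff]
  intro s t
  rw [← hs, ← hs, hf.eq_iff]

theorem smul_eq_of_leftAnn {a : A} {b : B} (h : leftAnn S a = leftAnn S b) {s : S}
    (hs : s • a = a) : s • b = b := by
  have := (leftAnn_eq_iff.1 h s 1).1 (by rw [hs, one_smul])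
  rwa [one_smul] at this

/-- A homomorphism of the orbit of `a` to that of `b`, as soon as `b` satisfies the relations which
hold for `a`. -/
noncomputable def orbitHom {a : A} {b : B} (h : leftAnn S a ⊆ leftAnn S b) :
    MulAction.orbit S a →[S] B where
  toFun x := x.2.choose • b
  map_smul' m x := by
    rw [smul_smul]
    refine mem_leftAnn.1 (h (mem_leftAnn.2 ?_))
    rw [mul_smul]
    have h1 := (m • x).2.choose_spec
    have h2 := x.2.choose_spec
    simp only at h1 h2
    rw [h1, h2]
    rfl

theorem orbitHom_smul {a : A} {b : B} (h : leftAnn S a ⊆ leftAnn S b) (s : S)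
    (hs : s • a ∈ MulAction.orbit S a) : orbitHom h ⟨s • a, hs⟩ = s • b :=
  mem_leftAnn.1 (h (mem_leftAnn.2 (Exists.choose_spec hs)))

theorem orbitHom_self {a : A} {b : B} (h : leftAnn S a ⊆ leftAnn S b) :
    orbitHom h ⟨a, MulAction.mem_orbit_self a⟩ = b := by
  have := orbitHom_smul h 1 (MulAction.mem_orbit a (1 : S))
  simpa using this

theorem isomorphicOrbits_iff {a : A} {b : B} :
    IsomorphicOrbits S a b ↔ leftAnn S a = leftAnn S b := by
  constructor
  · rintro ⟨f, hf, hab⟩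
    have h1 := leftAnn_of_injective (S := S) hf.1 (fun s x => map_smul f s x)
      ⟨a, MulAction.mem_orbit_self a⟩
    rw [hab] at h1
    have h2 := leftAnn_of_injective (S := S) (f := ((↑) : MulAction.orbit S a → A))
      Subtype.val_injective (fun s x => rfl) ⟨a, MulAction.mem_orbit_self a⟩
    have h3 := leftAnn_of_injective (S := S) (f := ((↑) : MulAction.orbit S b → B))
      Subtype.val_injective (fun s x => rfl) ⟨b, MulAction.mem_orbit_self b⟩
    exact h2.trans (h1.symm.trans h3.symm)
  · intro h
    have h3 := leftAnn_of_injective (S := S) (f := ((↑) : MulAction.orbit S b → B))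
      Subtype.val_injective (fun s x => rfl) ⟨b, MulAction.mem_orbit_self b⟩
    have h' := h.trans h3
    refine ⟨orbitHom h'.subset, ⟨?_, ?_⟩, orbitHom_self _⟩
    · rintro ⟨-, s, rfl⟩ ⟨-, t, rfl⟩ hst
      have h4 := (orbitHom_smul h'.subset s ⟨s, rfl⟩).symm.trans
        (hst.trans (orbitHom_smul h'.subset t ⟨t, rfl⟩))
      exact Subtype.ext ((leftAnn_eq_iff.1 h' s t).2 h4)
    · rintro ⟨-, s, rfl⟩
      exact ⟨⟨s • a, s, rfl⟩, orbitHom_smul h'.subset s ⟨s, rfl⟩⟩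

/-- The idempotent is `φ(a)`: applying `φ` to `φ(a) a = 1 a` gives `φ(a) φ(a) = φ(a)`, and `φ(a) a =
a` makes `φ` injective on the orbit. -/
theorem isActRegular_iff {a : A} :
    IsActRegular S a ↔ ∃ e : S, IsIdempotentElem e ∧ leftAnn S e = leftAnn S a := by
  constructor
  · rintro ⟨φ, hφ⟩
    have key : ∀ s t : S, s • a = t • a → s * φ ⟨a, MulAction.mem_orbit_self a⟩ =
        t * φ ⟨a, MulAction.mem_orbit_self a⟩ := by
      intro s t h
      rw [← smul_eq_mul, ← smul_eq_mul, ← map_smul, ← map_smul]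
      exact congrArg φ (Subtype.ext h)
    generalize φ ⟨a, MulAction.mem_orbit_self a⟩ = e at key hφ
    refine ⟨e, ?_, leftAnn_eq_iff.2 fun s t => ⟨fun h => ?_, key s t⟩⟩
    · exact (key e 1 (by simpa using hφ)).trans (one_mul e)
    · rw [← hφ, smul_smul, smul_smul]
      exact congrArg (· • a) h
  · rintro ⟨e, he, h⟩
    refine ⟨orbitHom h.symm.subset, ?_⟩
    rw [orbitHom_self]
    exact smul_eq_of_leftAnn h he

theorem isActRegular_congr {a : A} {b : B} (h : leftAnn S a = leftAnn S b) :
    IsActRegular S a ↔ IsActRegular S b := by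
  rw [isActRegular_iff, isActRegular_iff, h]

/-- Act-regularity depends only on the annihilator, hence not on the ambient subpolygon, and `Sa` is
the least subpolygon containing `a`. -/
theorem mem_regularCore_iff {a : S} : a ∈ regularCore S ↔ ∀ s, IsActRegular S (s * a) := by
  have key : ∀ (B : SubMulAction S S) (b : B), leftAnn S b = leftAnn S (b : S) := fun B b =>
    (leftAnn_of_injective (S := S) (f := ((↑) : B → S)) Subtype.val_injective
      (fun s x => rfl) b).symm
  constructor
  · rintro ⟨B, hB, hb⟩ s
    exact (isActRegular_congr (key B ⟨s • a, B.smul_mem s hb⟩)).1 (hB _)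
  · intro h
    refine ⟨⟨MulAction.orbit S a, ?_⟩, ?_, MulAction.mem_orbit_self a⟩
    · rintro c - ⟨s, rfl⟩
      exact ⟨c * s, mul_smul _ _ _⟩
    · rintro ⟨-, s, rfl⟩
      refine (isActRegular_congr (key _ _)).2 (h s)

theorem mul_mem_regularCore (s : S) {a : S} (ha : a ∈ regularCore S) : s * a ∈ regularCore S := by
  rw [mem_regularCore_iff] at ha ⊢
  intro t
  rw [← mul_assoc]
  exact ha _

theorem mem_regularCore_of_leftAnn_eq (hA : IsRegularPolygon S A) {a : A} {e : S}
    (h : leftAnn S e = leftAnn S a) : e ∈ regularCore S := by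
  rw [mem_regularCore_iff]
  intro s
  exact (isActRegular_congr (leftAnn_smul_congr h s)).2 (hA _)

theorem isRegularPolygon_iff : IsRegularPolygon S A ↔
    ∀ a : A, ∃ e ∈ regularCore S, IsIdempotentElem e ∧ leftAnn S e = leftAnn S a := by
  constructor
  · intro hA a
    obtain ⟨e, he, h⟩ := isActRegular_iff.1 (hA a)
    exact ⟨e, mem_regularCore_of_leftAnn_eq hA h, he, h⟩
  · intro h a
    obtain ⟨e, -, he⟩ := h a
    exact isActRegular_iff.2 ⟨e, he⟩

theorem isRegularPolygon_sum (hA : IsRegularPolygon S A) (hB : IsRegularPolygon S B) :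
    IsRegularPolygon S (A ⊕ B) := by
  rintro (a | b)
  · exact (isActRegular_congr (leftAnn_of_injective Sum.inl_injective (fun s a => rfl) a)).2 (hA a)
  · exact (isActRegular_congr (leftAnn_of_injective Sum.inr_injective (fun s a => rfl) b)).2 (hB b)

theorem exists_idempotent {a : S} (ha : a ∈ regularCore S) :
    ∃ e ∈ regularCore S, IsIdempotentElem e ∧ leftAnn S e = leftAnn S a ∧ e * a = a := by
  obtain ⟨e, he, h⟩ := isActRegular_iff.1 (mem_regularCore_iff.1 ha 1)
  rw [one_mul] at h
  refine ⟨e, ?_, he, h, smul_eq_of_leftAnn h he⟩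
  rw [mem_regularCore_iff] at ha ⊢
  exact fun s => (isActRegular_congr (leftAnn_smul_congr h s)).2 (ha s)

theorem isRegularPolygon_orbit {a : S} (ha : a ∈ regularCore S) :
    IsRegularPolygon S (MulAction.orbit S a) := by
  rintro ⟨-, s, rfl⟩
  exact (isActRegular_congr (leftAnn_of_injective (S := S) (f := ((↑) : MulAction.orbit S a → S))
    Subtype.val_injective (fun s x => rfl) _)).1 (mem_regularCore_iff.1 ha s)

end Annihilators

/-! ### Regular cores with minimal principal left ideals -/

section CoreStructure

variable {S : Type u} [Monoid S]

/-- All principal left ideals generated by elements of the regular core are minimal. -/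
def HasMinimalCore (S : Type u) [Monoid S] : Prop :=
  ∀ a ∈ regularCore S, ∀ s : S, ∃ t : S, t * (s * a) = a

theorem HasMinimalCore.orbit_mul (hmin : HasMinimalCore S) {a : S} (ha : a ∈ regularCore S) (s : S) :
    MulAction.orbit S (s * a) = MulAction.orbit S a := by
  ext b
  constructor
  · rintro ⟨t, rfl⟩
    exact ⟨t * s, mul_smul t s a⟩
  · rintro ⟨t, rfl⟩
    obtain ⟨r, hr⟩ := hmin a ha s
    exact ⟨t * r, by simp only [smul_eq_mul, mul_assoc, hr]⟩

/-- The local monoid `eSe` is a group: by minimality each of its elements has a left inverse in it.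
-/
theorem HasMinimalCore.exists_inv (hmin : HasMinimalCore S) {e : S} (heR : e ∈ regularCore S) (he : IsIdempotentElem e)
    {x : S} (hex : e * x = x) (hxe : x * e = x) :
    ∃ y, e * y = y ∧ y * e = y ∧ y * x = e ∧ x * y = e := by
  have he' : e * e = e := he
  have key : ∀ x : S, e * x = x → x * e = x → ∃ y, e * y = y ∧ y * e = y ∧ y * x = e := by
    intro x hex hxe
    obtain ⟨t, ht⟩ := hmin e heR x
    rw [hxe] at ht
    refine ⟨e * t * e, ?_, ?_, ?_⟩
    · rw [← mul_assoc, ← mul_assoc, he']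
    · rw [mul_assoc, he']
    · rw [mul_assoc, hex, mul_assoc, ht, he']
  obtain ⟨y, hy1, hy2, hy3⟩ := key x hex hxe
  obtain ⟨z, hz1, hz2, hz3⟩ := key y hy1 hy2
  have hzx : z = x := by rw [← hz2, ← hy3, ← mul_assoc, hz3, hex]
  exact ⟨y, hy1, hy2, hy3, hzx ▸ hz3⟩

/-- The product `fe` is an idempotent of the group `eSe`, so it is the identity `e`. -/
theorem HasMinimalCore.mul_eq_left (hmin : HasMinimalCore S) {e f : S} (heR : e ∈ regularCore S) (he : IsIdempotentElem e)
    (h : e * f = f) (hf : IsIdempotentElem f) : f * e = e := by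
  have he' : e * e = e := he
  have hf' : f * f = f := hf
  have h1 : e * (f * e) = f * e := by rw [← mul_assoc, h]
  obtain ⟨y, -, -, hy, -⟩ := hmin.exists_inv heR he h1 (by rw [mul_assoc, he'])
  calc f * e = y * (f * e) * (f * e) := by rw [hy, h1]
    _ = y * (f * (e * f) * e) := by simp only [mul_assoc]
    _ = e := by rw [h, hf', hy]

/-- This turns having the annihilator of `e` into a single equation. If the idempotent `f` has the
annihilator of `a`, then `ef = f`, hence `fe = e`. So `e` and `f` generate the same right ideal, and
left multiples of one are equal exactly when those of the other are. -/
theorem HasMinimalCore.leftAnn_eq (hmin : HasMinimalCore S) {A : Type v} [MulAction S A] (hA : IsRegularPolygon S A)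
    {e : S} (heR : e ∈ regularCore S) (he : IsIdempotentElem e) {a : A} (h : e • a = a) :
    leftAnn S a = leftAnn S e := by
  obtain ⟨f, -, hf, hfa⟩ := isRegularPolygon_iff.1 hA a
  have hef : e * f = f := smul_eq_of_leftAnn hfa.symm h
  have hfe := hmin.mul_eq_left heR he hef hf
  rw [← hfa, leftAnn_eq_iff]
  intro s t
  simp only [smul_eq_mul]
  constructor
  · intro h
    rw [← hfe, ← mul_assoc, h, mul_assoc]
  · intro h
    rw [← hef, ← mul_assoc, h, mul_assoc]

theorem HasMinimalCore.leftAnn_eq_of_mem (hmin : HasMinimalCore S) {e x : S} (hx : x ∈ regularCore S)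
    (heR : e ∈ regularCore S) (he : IsIdempotentElem e) (h : e * x = x) :
    leftAnn S x = leftAnn S e := by
  obtain ⟨f, hfR, hf, hfx, -⟩ := exists_idempotent hx
  have hef : e * f = f := smul_eq_of_leftAnn (S := S) (a := x) (b := f) hfx.symm h
  have key := hmin.leftAnn_eq (isRegularPolygon_orbit hfR) heR he
    (a := ⟨f, MulAction.mem_orbit_self f⟩) (Subtype.ext hef)
  rw [← hfx, ← key]
  exact leftAnn_of_injective (S := S) (f := ((↑) : MulAction.orbit S f → S))
    Subtype.val_injective (fun s x => rfl) ⟨f, MulAction.mem_orbit_self f⟩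

/-- Each element of the regular core lies in a subgroup of it. -/
theorem HasMinimalCore.exists_identity (hmin : HasMinimalCore S) {x : S} (hx : x ∈ regularCore S) :
    ∃ f ∈ regularCore S, IsIdempotentElem f ∧ f * x = x ∧ x * f = x ∧
      leftAnn S f = leftAnn S x ∧ MulAction.orbit S f = MulAction.orbit S x := by
  obtain ⟨e, heR, he, -, hex⟩ := exists_idempotent hx
  have he' : e * e = e := he
  -- With `t` the inverse of `xe` in the group `eSe`, one has `xt = e`, and `tx` is the identity
  -- sought.
  obtain ⟨t, ht1, ht2, ht3, ht4⟩ := hmin.exists_inv heR he (x := x * e)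
    (by rw [← mul_assoc, hex]) (by rw [mul_assoc, he'])
  have hxt : x * t = e := by rw [← ht4, mul_assoc, ht1]
  have hfx : t * x * x = x := by
    calc t * x * x = t * (x * (e * x)) := by rw [hex, mul_assoc]
      _ = t * (x * e) * x := by simp only [mul_assoc]
      _ = x := by rw [ht3, hex]
  have hff : IsIdempotentElem (t * x) := by
    change t * x * (t * x) = t * x
    rw [mul_assoc t x, ← mul_assoc x t, hxt, hex]
  exact ⟨t * x, mul_mem_regularCore t hx, hff, hfx, by rw [← mul_assoc, hxt, hex],
    (hmin.leftAnn_eq_of_mem hx (mul_mem_regularCore t hx) hff hfx).symm, hmin.orbit_mul hx t⟩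

/-- The decomposition of a regular core all of whose principal left ideals are minimal into
groups. -/
def HasMinimalCore.band (hmin : HasMinimalCore S) : RectangularBandOfGroups (regularCore S) where
  I := Set.range fun a : regularCore S => leftAnn S (a : S)
  J := Set.range fun a : regularCore S => MulAction.orbit S (a : S)
  component i j := {x | leftAnn S (x : S) = i ∧ MulAction.orbit S (x : S) = j}
  exists_mem x := ⟨⟨_, x, rfl⟩, ⟨_, x, rfl⟩, rfl, rfl⟩
  eq_of_mem := fun h h' =>
    ⟨Subtype.ext (h.1.symm.trans h'.1), Subtype.ext (h.2.symm.trans h'.2)⟩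
  mul_mem := by
    rintro x y i k j l ⟨hx, -⟩ ⟨-, hy⟩
    refine ⟨?_, ?_⟩
    · obtain ⟨f, hfR, hf, hfx, -, hfa, -⟩ := hmin.exists_identity x.2
      rw [← hx, ← hfa]
      exact hmin.leftAnn_eq_of_mem (x * y).2 hfR hf
        (by rw [MulMemClass.coe_mul, ← mul_assoc, hfx])
    · rw [← hy]
      exact hmin.orbit_mul y.2 _
  isGroupSubset := by
    rintro ⟨-, a, rfl⟩ ⟨-, b, rfl⟩
    have hab : leftAnn S ((a * b : regularCore S) : S) = leftAnn S (a : S) := by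
      obtain ⟨f, hfR, hf, hfx, -, hfa, -⟩ := hmin.exists_identity a.2
      rw [← hfa]
      exact hmin.leftAnn_eq_of_mem (a * b).2 hfR hf
        (by rw [MulMemClass.coe_mul, ← mul_assoc, hfx])
    have hab' : MulAction.orbit S ((a * b : regularCore S) : S) = MulAction.orbit S (b : S) :=
      hmin.orbit_mul b.2 _
    -- The product `ab` lies in the row of `a` and the column of `b`, so its local identity serves
    -- for the whole component.
    obtain ⟨f, hfR, hf, -, -, hfa, hfo⟩ := hmin.exists_identity (a * b).2
    rw [hab] at hfa
    rw [hab'] at hfo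
    have left : ∀ {x : S}, leftAnn S x = leftAnn S (a : S) → f * x = x := fun h =>
      smul_eq_of_leftAnn (S := S) (a := f) (hfa.trans h.symm) hf
    have right : ∀ {x : S}, MulAction.orbit S x = MulAction.orbit S (b : S) → x * f = x := by
      intro x h
      have := MulAction.mem_orbit_self (M := S) x
      rw [h, ← hfo] at this
      obtain ⟨t, rfl⟩ := this
      exact (mul_assoc t f f).trans (congrArg (t * ·) hf)
    have mem : ∀ {x : S} (hx : x ∈ regularCore S), f * x = x → x * f = x →
        leftAnn S x = leftAnn S (a : S) ∧ MulAction.orbit S x = MulAction.orbit S (b : S) := by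
      intro x hx h1 h2
      refine ⟨(hmin.leftAnn_eq_of_mem hx hfR hf h1).trans hfa, ?_⟩
      rw [← h2, hmin.orbit_mul hfR, hfo]
    refine ⟨?_, ⟨f, hfR⟩, ⟨hfa, hfo⟩, ?_, ?_⟩
    · rintro x ⟨hx1, hx2⟩ y ⟨hy1, hy2⟩
      refine mem (x * y).2 ?_ ?_
      · rw [MulMemClass.coe_mul, ← mul_assoc, left hx1]
      · rw [MulMemClass.coe_mul, mul_assoc, right hy2]
    · rintro x ⟨hx1, hx2⟩
      exact ⟨Subtype.ext (left hx1), Subtype.ext (right hx2)⟩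
    · rintro x ⟨hx1, hx2⟩
      obtain ⟨y, hy1, hy2, hy3, hy4⟩ := hmin.exists_inv hfR hf (left hx1) (right hx2)
      have hyR : y ∈ regularCore S := by
        rw [← hy2]
        exact mul_mem_regularCore y hfR
      exact ⟨⟨y, hyR⟩, mem hyR hy1 hy2, Subtype.ext hy4, Subtype.ext hy3⟩

/-- With `f` the identity of the component, the map `y ↦ (ann y, fy)` is injective on `Sf` and its
second coordinate lies in the component. Finitely many annihilators and a finite component would
make `Sf` finite. -/
theorem HasMinimalCore.infinite_band_component (hmin : HasMinimalCore S)
    (hfin : (leftAnn S '' (regularCore S : Set S)).Finite)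
    (hinf : ∀ a ∈ regularCore S, (MulAction.orbit S a).Infinite)
    (i : hmin.band.I) (j : hmin.band.J) : (hmin.band.component i j).Infinite := by
  intro hcomp
  obtain ⟨-, f, ⟨hf1, hf2⟩, hid, -⟩ := hmin.band.isGroupSubset i j
  have hff : (f : S) * f = f := congrArg Subtype.val (hid f ⟨hf1, hf2⟩).1
  refine hinf f f.2 (Set.Finite.of_finite_image (f := fun y : S => (leftAnn S y, (f : S) * y))
    ((hfin.prod (hcomp.image Subtype.val)).subset ?_) ?_)
  · rintro - ⟨-, ⟨s, rfl⟩, rfl⟩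
    have hy := mul_mem_regularCore s f.2
    refine ⟨⟨_, hy, rfl⟩, f * ⟨_, hy⟩, ⟨?_, ?_⟩, rfl⟩
    · rw [← hf1]
      exact hmin.leftAnn_eq_of_mem (f * ⟨_, hy⟩ : regularCore S).2 f.2 hff
        (by rw [MulMemClass.coe_mul, ← mul_assoc, hff])
    · rw [← hf2]
      change MulAction.orbit S ((f : S) * (s * f)) = _
      rw [hmin.orbit_mul hy, hmin.orbit_mul f.2]
  · rintro - ⟨s, rfl⟩ - ⟨t, rfl⟩ h
    simp only [smul_eq_mul, Prod.mk.injEq] at h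
    obtain ⟨h1, h2⟩ := h
    -- The local identity `g` of `sf` fixes `tf` too, since the annihilators agree, and `gf = g`.
    -- Hence multiplying by `g` recovers `sf` and `tf` from `f(sf) = f(tf)`.
    obtain ⟨g, hgR, hg, hgs, -, hga, hgo⟩ := hmin.exists_identity (mul_mem_regularCore s f.2)
    have hgt : g * (t * f) = t * f :=
      smul_eq_of_leftAnn (S := S) (a := g) (b := t * (f : S)) (hga.trans h1) hg
    have hgf : g * f = g := by
      have := MulAction.mem_orbit_self (M := S) g
      rw [hgo, hmin.orbit_mul f.2] at this
      obtain ⟨r, rfl⟩ := this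
      exact (mul_assoc r (f : S) f).trans (congrArg (r * ·) hff)
    simp only [smul_eq_mul]
    rw [← hgs, ← hgt, ← hgf, mul_assoc, h2, mul_assoc g]

end CoreStructure

/-! ### From a rectangular band of groups back to minimality and finiteness -/

section Bands

variable {S : Type u} [Monoid S]

theorem RectangularBandOfGroups.exists_identity
    (D : RectangularBandOfGroups (regularCore S)) (i : D.I) (j : D.J) :
    ∃ e ∈ D.component i j, ∀ y ∈ D.component i j,
      e * y = y ∧ y * e = y ∧ ∃ z ∈ D.component i j, y * z = e ∧ z * y = e := by
  obtain ⟨-, e, he, h1, h2⟩ := D.isGroupSubset i j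
  exact ⟨e, he, fun y hy => ⟨(h1 y hy).1, (h1 y hy).2, h2 y hy⟩⟩

theorem RectangularBandOfGroups.hasMinimalCore (D : RectangularBandOfGroups (regularCore S)) : HasMinimalCore S := by
  intro a ha s
  obtain ⟨i, j, haij⟩ := D.exists_mem ⟨a, ha⟩
  obtain ⟨e, he, h⟩ := D.exists_identity i j
  have hb : (⟨s * a, mul_mem_regularCore s ha⟩ : regularCore S) * e =
      ⟨s * a, mul_mem_regularCore s ha⟩ := by
    refine Subtype.ext ?_
    have := congrArg Subtype.val (h _ haij).2.1
    simp only [MulMemClass.coe_mul] at this ⊢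
    rw [mul_assoc, this]
  obtain ⟨k, l, hkl⟩ := D.exists_mem ⟨s * a, mul_mem_regularCore s ha⟩
  -- As `sa = (sa)e` lies in column `j`, the product `e(sa)` is back in the group of `a` and can be
  -- inverted there.
  have hmem := D.mul_mem he (hb ▸ D.mul_mem hkl he)
  obtain ⟨-, -, z, -, -, hz⟩ := h _ hmem
  refine ⟨a * (z * e), ?_⟩
  have h1 := congrArg Subtype.val (h _ haij).2.1
  have h2 := congrArg Subtype.val hz
  simp only [MulMemClass.coe_mul] at h1 h2
  rw [mul_assoc, mul_assoc, h2, h1]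

/-- Inverting `ab` in the group of `b` shows `b ∈ aR`, so relations satisfied by `a` pass to `b`. By
symmetry the annihilator depends only on the row. -/
theorem RectangularBandOfGroups.leftAnn_subset (D : RectangularBandOfGroups (regularCore S)) {i : D.I} {j l : D.J} {a b : regularCore S}
    (ha : a ∈ D.component i j) (hb : b ∈ D.component i l) :
    leftAnn S (a : S) ⊆ leftAnn S (b : S) := by
  obtain ⟨e, he, h⟩ := D.exists_identity i l
  obtain ⟨-, -, w, -, hw, -⟩ := h _ (D.mul_mem ha hb)
  have key : (a : S) * (b * w * b) = b := by
    have h1 := congrArg Subtype.val (h b hb).1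
    have h2 := congrArg Subtype.val hw
    simp only [MulMemClass.coe_mul] at h1 h2
    rw [← mul_assoc, ← mul_assoc, h2, h1]
  rintro ⟨s, t⟩ hst
  rw [mem_leftAnn] at hst ⊢
  simp only [smul_eq_mul] at hst ⊢
  rw [← key, ← mul_assoc, hst, mul_assoc]

theorem RectangularBandOfGroups.finite_leftAnn (D : RectangularBandOfGroups (regularCore S)) [Finite D.I] :
    (leftAnn S '' (regularCore S : Set S)).Finite := by
  -- The union of the annihilators over a row depends on `i` alone and equals each of them.
  refine (Set.finite_range fun i : D.I =>
    {p : S × S | ∃ j, ∃ x ∈ D.component i j, p ∈ leftAnn S (x : S)}).subset ?_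
  rintro - ⟨a, ha, rfl⟩
  obtain ⟨i, j, haij⟩ := D.exists_mem ⟨a, ha⟩
  refine ⟨i, Set.Subset.antisymm ?_ fun p hp => ⟨j, _, haij, hp⟩⟩
  rintro p ⟨l, x, hx, hp⟩
  exact D.leftAnn_subset hx haij hp

theorem RectangularBandOfGroups.infinite_orbit (D : RectangularBandOfGroups (regularCore S)) (hD : ∀ i j, (D.component i j).Infinite) {a : S}
    (ha : a ∈ regularCore S) : (MulAction.orbit S a).Infinite := by
  obtain ⟨i, j, haij⟩ := D.exists_mem ⟨a, ha⟩
  obtain ⟨e, he, h⟩ := D.exists_identity i j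
  obtain ⟨-, -, z, -, -, hz⟩ := h _ haij
  refine ((hD i j).image Subtype.val_injective.injOn).mono ?_
  rintro - ⟨x, hx, rfl⟩
  refine ⟨x * z, ?_⟩
  have h1 := congrArg Subtype.val (h _ hx).2.1
  have h2 := congrArg Subtype.val hz
  simp only [MulMemClass.coe_mul] at h1 h2
  simp only [smul_eq_mul]
  rw [mul_assoc, h2, h1]

end Bands

/-! ### Sentences quantifying a formula in one variable -/

section Sentences

variable {L : FirstOrder.Language.{u, 0}}

/-- The sentence which says that the formula `Φ` holds for all elements. -/
noncomputable def forallSentence (Φ : L.Formula (Fin 1)) : L.Sentence :=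
  (Φ.relabel Sum.inr : L.Formula (Empty ⊕ Fin 1)).iAlls (Fin 1)

/-- The sentence which says that the formula `Φ` holds for some element. -/
noncomputable def existsSentence (Φ : L.Formula (Fin 1)) : L.Sentence :=
  (Φ.relabel Sum.inr : L.Formula (Empty ⊕ Fin 1)).iExs (Fin 1)

theorem forall_fin_one_fun {M : Type v} {p : (Fin 1 → M) → Prop} :
    (∀ x, p x) ↔ ∀ a, p ![a] :=
  ⟨fun h a => h _, fun h x => by
    have : x = ![x 0] := by
      ext i
      fin_cases i
      rfl
    rw [this]
    exact h _⟩

theorem exists_fin_one_fun {M : Type v} {p : (Fin 1 → M) → Prop} :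
    (∃ x, p x) ↔ ∃ a, p ![a] := by
  rw [← not_iff_not, not_exists, not_exists, forall_fin_one_fun]

theorem realize_forallSentence {M : Type v} [L.Structure M] {Φ : L.Formula (Fin 1)} :
    M ⊨ forallSentence Φ ↔ ∀ a : M, Φ.Realize ![a] := by
  rw [← forall_fin_one_fun (p := fun x => Φ.Realize x), Language.Sentence.Realize, forallSentence,
    Language.Formula.realize_iAlls]
  simp only [Language.Formula.realize_relabel]
  rfl

theorem realize_existsSentence {M : Type v} [L.Structure M] {Φ : L.Formula (Fin 1)} :
    M ⊨ existsSentence Φ ↔ ∃ a : M, Φ.Realize ![a] := by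
  rw [← exists_fin_one_fun (p := fun x => Φ.Realize x), Language.Sentence.Realize, existsSentence,
    Language.Formula.realize_iExs]
  simp only [Language.Formula.realize_relabel]
  rfl

end Sentences

/-! ### Formulas and embeddings in the language of polygons -/

section PolygonFormulas

variable {S : Type u}

/-- The symbol of the action of `s` in the language of polygons. -/
def actSymbol (s : S) : (polygonLanguage S).Functions 1 := PolygonFunctions.act s

/-- The term `s t` in the language of polygons. -/
def actTerm {α : Type v} (s : S) (t : (polygonLanguage S).Term α) : (polygonLanguage S).Term α :=
  Language.Functions.apply₁ (actSymbol s) t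

/-- The formula `s x = t x` in the language of polygons. -/
def actEq (s t : S) : (polygonLanguage S).Formula (Fin 1) :=
  Language.Term.equal (actTerm s (Language.Term.var 0)) (actTerm t (Language.Term.var 0))

/-- The formula `∃ y, Φ(y) ∧ s y = x` in the language of polygons. -/
noncomputable def existsAct (Φ : (polygonLanguage S).Formula (Fin 1)) (s : S) :
    (polygonLanguage S).Formula (Fin 1) :=
  ((Φ.relabel Sum.inr : (polygonLanguage S).Formula (Fin 1 ⊕ Fin 1)) ⊓
    Language.Term.equal (actTerm s (Language.Term.var (Sum.inr 0)))
      (Language.Term.var (Sum.inl 0))).iExs (Fin 1)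

variable [Monoid S] {A : Type v} [MulAction S A] {B : Type w} [MulAction S B]

@[simp]
theorem realize_actTerm {α : Type*} {s : S} {t : (polygonLanguage S).Term α} {x : α → A} :
    (actTerm s t).realize x = s • t.realize x := by
  exact Language.Term.realize_functions_apply₁

@[simp]
theorem realize_actEq {s t : S} {a : A} : (actEq s t).Realize ![a] ↔ s • a = t • a := by
  simp [actEq]

theorem realize_existsAct {Φ : (polygonLanguage S).Formula (Fin 1)} {s : S} {a : A} :
    (existsAct Φ s).Realize ![a] ↔ ∃ b : A, Φ.Realize ![b] ∧ s • b = a := by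
  rw [existsAct, Language.Formula.realize_iExs, exists_fin_one_fun]
  simp only [Language.Formula.realize_inf, Language.Formula.realize_relabel,
    Language.Formula.realize_equal, realize_actTerm, Language.Term.realize_var]
  rfl

/-- An injective map which commutes with the actions is an embedding of polygons as structures. -/
def polygonEmbedding (f : A → B) (hf : Function.Injective f)
    (hs : ∀ (s : S) a, f (s • a) = s • f a) : A ↪[polygonLanguage S] B where
  toFun := f
  inj' := hf
  map_fun' := by
    rintro n ⟨s⟩ x
    exact hs s (x 0)
  map_rel' := by
    rintro n ⟨⟩

/-- A bijection which commutes with the actions is an isomorphism of polygons as structures. -/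
def polygonEquiv (f : A ≃ B) (hs : ∀ (s : S) a, f (s • a) = s • f a) :
    A ≃[polygonLanguage S] B where
  toEquiv := f
  map_fun' := by
    rintro n ⟨s⟩ x
    exact hs s (x 0)
  map_rel' := by
    rintro n ⟨⟩

theorem polygonEmbedding_smul (f : A ↪[polygonLanguage S] B) (s : S) (a : A) :
    f (s • a) = s • f a :=
  f.map_fun (actSymbol s) ![a]

end PolygonFormulas

/-! ### The class of regular polygons and its theory -/

section Classes

variable {S : Type u} [Monoid S]

theorem mem_regularPolygons {A : Type u} [MulAction S A] [hne : Nonempty A]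
    (hA : IsRegularPolygon S A) :
    (⟨A, polygonStructure S A⟩ : Bundled (polygonLanguage S).Structure) ∈ regularPolygons S :=
  ⟨hne, inferInstance, rfl, hA⟩

theorem exists_eq_of_mem_regularPolygons {M : Bundled.{u} (polygonLanguage S).Structure}
    (hM : M ∈ regularPolygons S) : ∃ (A : Type u) (_ : MulAction S A) (_ : Nonempty A),
      IsRegularPolygon S A ∧ M = ⟨A, polygonStructure S A⟩ := by
  obtain ⟨A, str⟩ := M
  obtain ⟨hne, act, hstr, hA⟩ := hM
  exact ⟨A, act, hne, hA,
    congrArg (fun st => (⟨A, st⟩ : Bundled.{u} (polygonLanguage S).Structure)) hstr⟩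

theorem model_classTheory {L : FirstOrder.Language.{u, 0}} {K : Set (Bundled.{u} L.Structure)}
    {M : Bundled.{u} L.Structure} (hM : M ∈ K) : M ⊨ classTheory K :=
  (Language.Theory.model_iff _).2 fun _ hφ => hφ M hM

theorem IsAxiomatizable.mem_regularPolygons (hK : IsAxiomatizable (regularPolygons S))
    {M : Bundled.{u} (polygonLanguage S).Structure} [hne : Nonempty M]
    (hM : M ⊨ classTheory (regularPolygons S)) : M ∈ regularPolygons S := by
  obtain ⟨Z, hZ⟩ := hK
  exact (hZ M hne).2 (hM.mono fun φ hφ N hN =>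
    (Language.Theory.model_iff _).1 ((hZ N hN.1).1 hN) φ hφ)

/-- The largest regular subpolygon of a polygon. -/
def regularPart (S : Type u) [Monoid S] (A : Type v) [MulAction S A] : SubMulAction S A where
  carrier := {a | ∀ s : S, IsActRegular S (s • a)}
  smul_mem' s a ha t := by
    rw [smul_smul]
    exact ha _

theorem leftAnn_coe {A : Type v} [MulAction S A] {B : SubMulAction S A} (b : B) :
    leftAnn S (b : A) = leftAnn S b :=
  leftAnn_of_injective (S := S) (f := ((↑) : B → A)) Subtype.val_injective (fun _ _ => rfl) b

theorem isRegularPolygon_regularPart {A : Type v} [MulAction S A] :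
    IsRegularPolygon S (regularPart S A) := by
  rintro ⟨a, ha⟩
  have := ha 1
  rw [one_smul] at this
  exact (isActRegular_congr (leftAnn_coe _)).1 this

theorem mem_regularPart {A : Type v} [MulAction S A] {a : A} {e : S} (he : e ∈ regularCore S)
    (h : leftAnn S e = leftAnn S a) : a ∈ regularPart S A := fun s =>
  (isActRegular_congr (leftAnn_smul_congr h s)).1 (mem_regularCore_iff.1 he s)

theorem mem_regularPart_self {a : S} : a ∈ regularPart S S ↔ a ∈ regularCore S :=
  mem_regularCore_iff.symm

theorem regularPolygons_nonempty (hR : (regularCore S : Set S).Nonempty) :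
    (regularPolygons S).Nonempty := by
  obtain ⟨a, ha⟩ := hR
  have : Nonempty (regularPart S S) := ⟨⟨a, mem_regularPart_self.2 ha⟩⟩
  exact ⟨_, mem_regularPolygons (isRegularPolygon_regularPart (S := S) (A := S))⟩

theorem IsCompleteClass.realize {L : FirstOrder.Language.{u, 0}}
    {K : Set (Bundled.{u} L.Structure)} (hK : IsCompleteClass K) {M N : Bundled.{u} L.Structure}
    [Nonempty M] [Nonempty N] (hM : M ∈ K) (hN : N ∈ K) {φ : L.Sentence} (h : M ⊨ φ) : N ⊨ φ := by
  have := model_classTheory hM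
  have := model_classTheory hN
  rwa [Language.Theory.IsComplete.realize_sentence_iff hK,
    ← Language.Theory.IsComplete.realize_sentence_iff hK φ M]

/-- Joint embedding: two regular polygons are both elementary in their disjoint sum, hence
elementarily equivalent. -/
theorem isCompleteClass_of_modelComplete (hR : (regularCore S : Set S).Nonempty)
    (hmc : IsModelCompleteClass (regularPolygons S)) :
    IsCompleteClass (regularPolygons S) := by
  have elem : ∀ (A B : Type u) [MulAction S A] [MulAction S B] [Nonempty A],
      IsRegularPolygon S A → IsRegularPolygon S B → ∀ f : A ↪[polygonLanguage S] B,
      A ≅[polygonLanguage S] B := by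
    intro A B _ _ _ hA hB f
    have : Nonempty B := Nonempty.map f inferInstance
    have hA' := model_classTheory (mem_regularPolygons hA)
    have := Language.StrongHomClass.elementarilyEquivalent f.equivRange
    have hN := hmc.2 B (model_classTheory (mem_regularPolygons hB)) f.toHom.range
      (Nonempty.map f.equivRange inferInstance)
      (Language.StrongHomClass.theory_model f.equivRange)
    exact this.trans (Language.ElementarySubstructure.elementarilyEquivalent ⟨_, hN⟩)
  obtain ⟨M, hM⟩ := regularPolygons_nonempty hR
  refine ⟨hmc.1, fun φ => ?_⟩
  have equiv : ∀ N ∈ regularPolygons S, M ≅[polygonLanguage S] N := by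
    intro N hN
    obtain ⟨N, _, _, hN', rfl⟩ := exists_eq_of_mem_regularPolygons hN
    obtain ⟨M, _, _, hM', rfl⟩ := exists_eq_of_mem_regularPolygons hM
    have hMN := isRegularPolygon_sum hM' hN'
    exact (elem M (M ⊕ N) hM' hMN (polygonEmbedding _ Sum.inl_injective fun _ _ => rfl)).trans
      (elem N (M ⊕ N) hN' hMN (polygonEmbedding _ Sum.inr_injective fun _ _ => rfl)).symm
  by_cases h : M ⊨ φ
  · exact Or.inl (Language.Theory.models_sentence_of_mem fun N hN =>
      (Language.elementarilyEquivalent_iff.1 (equiv N hN) φ).1 h)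
  · refine Or.inr (Language.Theory.models_sentence_of_mem fun N hN => ?_)
    rw [Language.Sentence.realize_not, ← Language.elementarilyEquivalent_iff.1 (equiv N hN) φ]
    exact h

end Classes

/-! ### Cofree polygons -/

section Cofree

variable {S : Type u} [Monoid S]

/-- The cofree polygon of all maps `S → X`, on which `s` acts by `(s f)(t) = f(ts)`. -/
def CofreePolygon (S : Type u) (X : Type v) : Type max u v := S → X

instance {X : Type v} : MulAction S (CofreePolygon S X) where
  smul s f t := f (t * s)
  one_smul f := funext fun t => congrArg f (mul_one t)
  mul_smul s t f := funext fun r => congrArg f (mul_assoc r s t).symm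

theorem CofreePolygon.smul_eq_smul_iff {X : Type v} {s t : S} {f : CofreePolygon S X} :
    s • f = t • f ↔ ∀ r, f (r * s) = f (r * t) :=
  funext_iff

/-- If `se` and `e` have the same annihilator and `f` is an element of a sufficiently large cofree
polygon with this annihilator, then so is some `g` with `sg = f`. -/
theorem CofreePolygon.exists_smul_eq {e s : S} (hs : leftAnn S (s * e) = leftAnn S e)
    {f : CofreePolygon S (S × Set S)} (hf : leftAnn S f = leftAnn S e) :
    ∃ g : CofreePolygon S (S × Set S), leftAnn S g = leftAnn S e ∧ s • g = f := by
  classical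
  -- By Cantor's theorem some label `y` is never used by `f`; this is why the values are taken in `S
  -- × Set S`.
  obtain ⟨y, hy⟩ : ∃ y : Set S, ∀ t, (f t).2 ≠ y := by
    have := Function.cantor_surjective fun t => (f t).2
    simpa [Function.Surjective] using this
  rw [leftAnn_eq_iff] at hs hf
  simp only [smul_eq_mul] at hs hf
  -- The solution will be `g(t) = G(te)`. The equation `sg = f` forces `G(use) = f(u)`, which is
  -- consistent because `se`, `e` and `f` have the same annihilator. Off `Sse`, `G` is injective and
  -- its values carry the fresh label, so `g` satisfies no relation that `e` does not.
  let G : S → S × Set S := fun x =>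
    if h : ∃ u, u * (s * e) = x then f h.choose else (x, y)
  have hG : ∀ u, G (u * (s * e)) = f u := by
    intro u
    have h : ∃ v, v * (s * e) = u * (s * e) := ⟨u, rfl⟩
    have h1 := CofreePolygon.smul_eq_smul_iff.1
      ((hf _ _).2 ((hs _ _).1 h.choose_spec)) 1
    simp only [one_mul] at h1
    simp only [G, dif_pos h, h1]
  have hG' : ∀ x, (¬∃ u, u * (s * e) = x) → G x = (x, y) := fun x h => by
    simp only [G, dif_neg h]
  refine ⟨fun t => G (t * e), leftAnn_eq_iff.2 fun p q => ?_, funext fun t => ?_⟩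
  · refine CofreePolygon.smul_eq_smul_iff.trans ?_
    simp only [smul_eq_mul]
    constructor
    · intro h
      have h1 := h 1
      simp only [one_mul] at h1
      by_cases hp : ∃ u, u * (s * e) = p * e
      · by_cases hq : ∃ u, u * (s * e) = q * e
        · obtain ⟨a, ha⟩ := hp
          obtain ⟨b, hb⟩ := hq
          rw [← ha, ← hb, hs, ← hf, CofreePolygon.smul_eq_smul_iff]
          intro r
          have := h r
          rwa [mul_assoc, mul_assoc, ← ha, ← hb, ← mul_assoc, ← mul_assoc r b, hG, hG] at this
        · obtain ⟨a, ha⟩ := hp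
          rw [hG' _ hq, ← ha, hG] at h1
          exact (hy _ (congrArg Prod.snd h1)).elim
      · by_cases hq : ∃ u, u * (s * e) = q * e
        · obtain ⟨b, hb⟩ := hq
          rw [hG' _ hp, ← hb, hG] at h1
          exact (hy _ (congrArg Prod.snd h1.symm)).elim
        · rw [hG' _ hp, hG' _ hq] at h1
          exact congrArg Prod.fst h1
    · intro h r
      rw [mul_assoc, mul_assoc, h]
  · change G (t * s * e) = f t
    rw [mul_assoc, hG]

theorem CofreePolygon.exists_leftAnn_eq (e : S) :
    ∃ f : CofreePolygon S (S × Set S), leftAnn S f = leftAnn S e := by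
  refine ⟨fun t => (t * e, ∅), leftAnn_eq_iff.2 fun p q => ?_⟩
  refine CofreePolygon.smul_eq_smul_iff.trans ?_
  simp only [smul_eq_mul]
  constructor
  · intro h
    simpa using congrArg Prod.fst (h 1)
  · intro h r
    rw [mul_assoc, mul_assoc, h]

end Cofree

/-! ### Consequences of completeness and definable orbits -/

section CompleteClass

variable {S : Type u} [Monoid S]

/-- The formula `Φ` defines in all regular polygons the elements with the same annihilator as
`e`. -/
def DefinesOrbit (Φ : (polygonLanguage S).Formula (Fin 1)) (e : S) : Prop :=
  ∀ (A : Type u) [MulAction S A], IsRegularPolygon S A →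
    ∀ a : A, Φ.Realize ![a] ↔ leftAnn S a = leftAnn S e

theorem hasFormulaDefinableIsomorphicOrbits_iff : HasFormulaDefinableIsomorphicOrbits S ↔
    ∀ e ∈ regularCore S, IsIdempotentElem e → ∃ Φ, DefinesOrbit Φ e := by
  simp only [HasFormulaDefinableIsomorphicOrbits, DefinesOrbit, isomorphicOrbits_iff]

/-- Otherwise choose, for each finite set of annihilators, an element whose annihilator avoids it.
In an ultraproduct over these finite sets the resulting element satisfies some `Φ_e`, as the
ultraproduct is again regular. By Łoś the chosen annihilators are then `ann e` almost everywhere,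
yet almost every index set contains `ann e`. -/
theorem finite_leftAnn_of_axiomatizable (hax : IsAxiomatizable (regularPolygons S))
    (hdef : HasFormulaDefinableIsomorphicOrbits S) :
    (leftAnn S '' (regularCore S : Set S)).Finite := by
  by_contra hinf
  rw [hasFormulaDefinableIsomorphicOrbits_iff] at hdef
  have hx : ∀ s : Finset (Set (S × S)), ∃ a : regularPart S S, leftAnn S a ∉ s := by
    intro s
    obtain ⟨-, ⟨a, ha, rfl⟩, has⟩ := Set.Infinite.exists_notMem_finset hinf s
    exact ⟨⟨a, mem_regularPart_self.2 ha⟩, by rwa [← leftAnn_coe]⟩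
  choose x hx using hx
  have : Nonempty (regularPart S S) := ⟨x ∅⟩
  let U : Ultrafilter (Finset (Set (S × S))) := Ultrafilter.of Filter.atTop
  let M : Bundled.{u} (polygonLanguage S).Structure :=
    ⟨(U : Filter (Finset (Set (S × S)))).Product fun _ => regularPart S S, inferInstance⟩
  have hne : Nonempty M := ⟨Quotient.mk _ x⟩
  have hM : M ∈ regularPolygons S := by
    refine hax.mem_regularPolygons ((Language.Theory.model_iff _).2 fun φ hφ => ?_)
    exact (Language.Ultraproduct.sentence_realize φ).2 (Filter.Eventually.of_forall fun _ =>
      hφ _ (mem_regularPolygons isRegularPolygon_regularPart))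
  have key : ∀ (N : Bundled.{u} (polygonLanguage S).Structure) (_ : N ∈ regularPolygons S) (a : N),
      ∃ (e : S) (Φ : (polygonLanguage S).Formula (Fin 1)), DefinesOrbit Φ e ∧ Φ.Realize ![a] := by
    intro N hN a
    obtain ⟨A, _, _, hA, rfl⟩ := exists_eq_of_mem_regularPolygons hN
    obtain ⟨e, heR, he, hea⟩ := isRegularPolygon_iff.1 hA a
    obtain ⟨Φ, hΦ⟩ := hdef e heR he
    exact ⟨e, Φ, hΦ, (hΦ A hA a).2 hea.symm⟩
  obtain ⟨e, Φ, hΦ, hreal⟩ := key M hM (Quotient.mk _ x)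
  have h1 : ∀ᶠ s in (U : Filter (Finset (Set (S × S)))), Φ.Realize ![x s] := by
    have := (Language.Ultraproduct.realize_formula_cast (u := U)
      (M := fun _ => regularPart S S) Φ fun _ => x).1 (by
        refine (iff_of_eq (congrArg Φ.Realize (funext fun i => ?_))).1 hreal
        fin_cases i
        rfl)
    refine this.mono fun s hs => ?_
    refine (iff_of_eq (congrArg Φ.Realize (funext fun i => ?_))).1 hs
    fin_cases i
    rfl
  have h2 : ∀ᶠ s in (U : Filter (Finset (Set (S × S)))), leftAnn S e ∈ s :=
    (Ultrafilter.of_le _) ((Filter.eventually_ge_atTop {leftAnn S e}).mono fun s hs =>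
      hs (Finset.mem_singleton_self _))
  obtain ⟨s, hs1, hs2⟩ := (h1.and h2).exists
  exact hx s ((hΦ _ isRegularPolygon_regularPart (x s)).1 hs1 ▸ hs2)

/-- It suffices to treat an idempotent `e`. Completeness is used twice: to find in `Sse` an element
`rse` with the annihilator of `e`, and then to transfer the divisibility by `rs` from the cofree
polygon to `Se`. -/
theorem hasMinimalCore_of_complete (hK : IsCompleteClass (regularPolygons S))
    (hdef : HasFormulaDefinableIsomorphicOrbits S) : HasMinimalCore S := by
  rw [hasFormulaDefinableIsomorphicOrbits_iff] at hdef
  intro a ha s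
  obtain ⟨e, heR, he, hea, -⟩ := exists_idempotent ha
  obtain ⟨Φ, hΦ⟩ := hdef e heR he
  suffices h : ∃ t, t * (s * e) = e by
    obtain ⟨t, ht⟩ := h
    have := (leftAnn_eq_iff.1 hea (t * s) 1).1 (by simpa [mul_assoc] using ht)
    exact ⟨t, by simpa [mul_assoc] using this⟩
  have hse := mul_mem_regularCore s heR
  have instE : Nonempty (MulAction.orbit S e) := ⟨⟨e, MulAction.mem_orbit_self e⟩⟩
  have instS : Nonempty (MulAction.orbit S (s * e)) := ⟨⟨_, MulAction.mem_orbit_self _⟩⟩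
  have ann : ∀ {b : S} (x : MulAction.orbit S b), leftAnn S (x : S) = leftAnn S x := fun x =>
    leftAnn_of_injective (S := S) (f := Subtype.val) Subtype.val_injective (fun _ _ => rfl) x
  -- an element of the orbit of `s * e` which has the same annihilator as `e`
  obtain ⟨r, hr⟩ : ∃ r, leftAnn S (r * (s * e)) = leftAnn S e := by
    have h1 : MulAction.orbit S e ⊨ existsSentence Φ := realize_existsSentence.2
      ⟨⟨e, MulAction.mem_orbit_self e⟩, (hΦ _ (isRegularPolygon_orbit heR) _).2 (ann _).symm⟩
    have h2 := hK.realize (mem_regularPolygons (isRegularPolygon_orbit heR))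
      (mem_regularPolygons (isRegularPolygon_orbit hse)) h1
    obtain ⟨⟨-, r, rfl⟩, hx⟩ := realize_existsSentence.1 h2
    exact ⟨r, (ann _).trans ((hΦ _ (isRegularPolygon_orbit hse) _).1 hx)⟩
  rw [← mul_assoc] at hr
  let C := regularPart S (CofreePolygon S (S × Set S))
  have hC : IsRegularPolygon S C := isRegularPolygon_regularPart
  have instC : Nonempty C := by
    obtain ⟨f, hf⟩ := CofreePolygon.exists_leftAnn_eq e
    exact ⟨⟨f, mem_regularPart heR hf.symm⟩⟩
  -- In `C` every element with the annihilator of `e` is `rs` times another such element.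
  have h1 : C ⊨ forallSentence (Φ.imp (existsAct Φ (r * s))) := by
    refine realize_forallSentence.2 fun f => Language.Formula.realize_imp.2 fun hf => ?_
    obtain ⟨g, hg, hgf⟩ := CofreePolygon.exists_smul_eq hr
      ((leftAnn_coe f).trans ((hΦ C hC f).1 hf))
    exact realize_existsAct.2 ⟨⟨g, mem_regularPart heR hg.symm⟩,
      (hΦ C hC _).2 ((leftAnn_coe _).symm.trans hg), Subtype.ext hgf⟩
  have h2 := hK.realize (mem_regularPolygons hC)
    (mem_regularPolygons (isRegularPolygon_orbit heR)) h1
  obtain ⟨⟨-, t, rfl⟩, hy, hte⟩ := realize_existsAct.1 (Language.Formula.realize_imp.1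
    (realize_forallSentence.1 h2 ⟨e, MulAction.mem_orbit_self e⟩)
    ((hΦ _ (isRegularPolygon_orbit heR) _).2 (ann _).symm))
  have hy' := (ann _).trans ((hΦ _ (isRegularPolygon_orbit heR) _).1 hy)
  have hte' : r * s * (t * e) = e := congrArg Subtype.val hte
  -- Multiplying `rs(te) = e` by `t` gives `(trs)(te) = te`; since `te` and `e` have the same
  -- annihilator, `(trs)e = e`.
  have := (leftAnn_eq_iff.1 hy' (t * (r * s)) 1).1
    (by simp only [smul_eq_mul, mul_assoc, one_mul] at hte' ⊢; rw [hte'])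
  exact ⟨t * r, by simpa [mul_assoc] using this⟩

/-- If `Sa` had `n` elements, having at least `n + 1` elements would distinguish it from the
disjoint sum of two copies of it. -/
theorem infinite_orbit_of_complete (hK : IsCompleteClass (regularPolygons S)) {a : S}
    (ha : a ∈ regularCore S) : (MulAction.orbit S a).Infinite := by
  intro hfin
  have := hfin.to_subtype
  have inst : Nonempty (MulAction.orbit S a) := ⟨⟨a, MulAction.mem_orbit_self a⟩⟩
  have hA := isRegularPolygon_orbit ha
  have hpos := Nat.card_pos (α := MulAction.orbit S a)
  have h1 : (MulAction.orbit S a ⊕ MulAction.orbit S a) ⊨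
      Language.Sentence.cardGe (polygonLanguage S) (Nat.card (MulAction.orbit S a) + 1) := by
    rw [Language.Sentence.realize_cardGe, ← Nat.cast_card, Nat.card_sum]
    exact_mod_cast (by omega)
  have h2 := hK.realize (mem_regularPolygons (isRegularPolygon_sum hA hA))
    (mem_regularPolygons hA) h1
  rw [Language.Sentence.realize_cardGe, ← Nat.cast_card (α := MulAction.orbit S a)] at h2
  have : Nat.card (MulAction.orbit S a) + 1 ≤ Nat.card (MulAction.orbit S a) := by
    exact_mod_cast h2
  omega

end CompleteClass

/-! ### Axiomatizability and definability from minimality -/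

section Axioms

variable {S : Type u} [Monoid S]

theorem exists_mulAction_of_model {M : Bundled.{u} (polygonLanguage S).Structure}
    (hM : M ⊨ classTheory (regularPolygons S)) :
    ∃ (A : Type u) (_ : MulAction S A), M = ⟨A, polygonStructure S A⟩ := by
  have hreal : ∀ Φ : (polygonLanguage S).Formula (Fin 1),
      (∀ (A : Type u) [MulAction S A] (a : A), Φ.Realize ![a]) → ∀ a : M, Φ.Realize ![a] := by
    intro Φ hΦ
    refine realize_forallSentence.1 ((Language.Theory.model_iff _).1 hM _ fun N hN => ?_)
    obtain ⟨A, _, _, -, rfl⟩ := exists_eq_of_mem_regularPolygons hN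
    exact realize_forallSentence.2 fun a => hΦ A a
  obtain ⟨A, str⟩ := M
  have hone : ∀ a : A, Language.Structure.funMap (actSymbol (1 : S)) ![a] = a := by
    intro a
    have := hreal (Language.Term.equal (actTerm 1 (Language.Term.var 0)) (Language.Term.var 0))
      (fun A _ a => by simp) a
    simpa [actTerm, Language.Term.realize_functions_apply₁] using this
  have hmul : ∀ (s t : S) (a : A), Language.Structure.funMap (actSymbol (s * t)) ![a] =
      Language.Structure.funMap (actSymbol s) ![Language.Structure.funMap (actSymbol t) ![a] ] := by
    intro s t a
    have := hreal (Language.Term.equal (actTerm (s * t) (Language.Term.var 0))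
      (actTerm s (actTerm t (Language.Term.var 0)))) (fun A _ a => by simp [mul_smul]) a
    simpa [actTerm, Language.Term.realize_functions_apply₁] using this
  let act : MulAction S A :=
    { smul s a := Language.Structure.funMap (actSymbol s) ![a]
      one_smul := hone
      mul_smul := hmul }
  refine ⟨A, act, congrArg (fun st => (⟨A, st⟩ : Bundled.{u} (polygonLanguage S).Structure)) ?_⟩
  refine Language.Structure.ext ?_ ?_
  · funext n f x
    obtain ⟨s⟩ := f
    have : x = ![x 0] := by
      funext i
      fin_cases i
      rfl
    exact congrArg (Language.Structure.funMap (actSymbol s)) this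
  · funext n r
    exact r.elim

/-- Let `e_i` be idempotents representing the finitely many annihilators. The theory of the class
says that each `x` is fixed by some `e_i`, and that `e_i x = x` decides every equation `sx = tx` as
`e_i` does. This is regularity. -/
theorem isAxiomatizable_of_hasMinimalCore (hmin : HasMinimalCore S)
    (hfin : (leftAnn S '' (regularCore S : Set S)).Finite) :
    IsAxiomatizable (regularPolygons S) := by
  refine ⟨classTheory (regularPolygons S), fun M hne => ⟨model_classTheory, fun hM => ?_⟩⟩
  obtain ⟨A, _, rfl⟩ := exists_mulAction_of_model hM
  have hreal : ∀ Φ : (polygonLanguage S).Formula (Fin 1),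
      (∀ (B : Type u) [MulAction S B], IsRegularPolygon S B → ∀ b : B, Φ.Realize ![b]) →
      ∀ a : A, Φ.Realize ![a] := by
    intro Φ hΦ
    refine realize_forallSentence.1 ((Language.Theory.model_iff _).1 hM _ fun N hN => ?_)
    obtain ⟨B, _, _, hB, rfl⟩ := exists_eq_of_mem_regularPolygons hN
    exact realize_forallSentence.2 fun b => hΦ B hB b
  have hex : ∀ i : leftAnn S '' (regularCore S : Set S),
      ∃ e ∈ regularCore S, IsIdempotentElem e ∧ leftAnn S e = i := by
    rintro ⟨-, a, ha, rfl⟩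
    obtain ⟨e, heR, he, hea, -⟩ := exists_idempotent ha
    exact ⟨e, heR, he, hea⟩
  choose e heR he hei using hex
  have := hfin.to_subtype
  refine mem_regularPolygons (hne := hne) (isRegularPolygon_iff.2 fun a => ?_)
  obtain ⟨i, hi⟩ : ∃ i, e i • a = a := by
    have := hreal (Language.Formula.iSup fun i => actEq (e i) 1) (fun B _ hB b => by
      rw [Language.Formula.realize_iSup]
      obtain ⟨f, hfR, hf, hfb⟩ := isRegularPolygon_iff.1 hB b
      refine ⟨⟨_, f, hfR, rfl⟩, realize_actEq.2 ?_⟩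
      rw [one_smul]
      exact smul_eq_of_leftAnn ((hei _).trans hfb) (he _)) a
    simpa [Language.Formula.realize_iSup] using this
  refine ⟨e i, heR i, he i, leftAnn_eq_iff.2 fun s t => ?_⟩
  by_cases hst : s • e i = t • e i
  · refine iff_of_true hst ?_
    have := hreal ((actEq (e i) 1).imp (actEq s t)) (fun B _ hB b => by
      rw [Language.Formula.realize_imp, realize_actEq, realize_actEq, one_smul]
      intro hb
      exact (leftAnn_eq_iff.1 (hmin.leftAnn_eq hB (heR i) (he i) hb) s t).2 hst) a
    rw [Language.Formula.realize_imp, realize_actEq, realize_actEq, one_smul] at this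
    exact this hi
  · refine iff_of_false hst ?_
    have := hreal ((actEq (e i) 1).imp (actEq s t).not) (fun B _ hB b => by
      rw [Language.Formula.realize_imp, Language.Formula.realize_not, realize_actEq,
        realize_actEq, one_smul]
      intro hb
      exact fun h => hst ((leftAnn_eq_iff.1 (hmin.leftAnn_eq hB (heR i) (he i) hb) s t).1 h)) a
    rw [Language.Formula.realize_imp, Language.Formula.realize_not, realize_actEq,
      realize_actEq, one_smul] at this
    exact this hi

theorem hasFormulaDefinableIsomorphicOrbits_of_hasMinimalCore (hmin : HasMinimalCore S) :
    HasFormulaDefinableIsomorphicOrbits S := by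
  refine hasFormulaDefinableIsomorphicOrbits_iff.2 fun e heR he =>
    ⟨actEq e 1, fun A _ hA a => ?_⟩
  rw [realize_actEq, one_smul]
  exact ⟨hmin.leftAnn_eq hA heR he, fun h => smul_eq_of_leftAnn h.symm he⟩

end Axioms

/-! ### Decomposition of extensions into copies of one orbit -/

section Decomposition

variable {S : Type u} [Monoid S]

theorem HasMinimalCore.exists_smul_smul (hmin : HasMinimalCore S) {A : Type v} [MulAction S A]
    (hA : IsRegularPolygon S A) (s : S) (a : A) : ∃ t : S, t • s • a = a := by
  obtain ⟨e, heR, -, hea⟩ := isRegularPolygon_iff.1 hA a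
  obtain ⟨t, ht⟩ := hmin e heR s
  refine ⟨t, ?_⟩
  rw [smul_smul]
  exact smul_eq_of_leftAnn hea (by rwa [smul_eq_mul, mul_assoc])

theorem HasMinimalCore.orbit_smul (hmin : HasMinimalCore S) {A : Type v} [MulAction S A]
    (hA : IsRegularPolygon S A) (s : S) (a : A) :
    MulAction.orbit S (s • a) = MulAction.orbit S a := by
  ext b
  constructor
  · rintro ⟨t, rfl⟩
    exact ⟨t * s, mul_smul t s a⟩
  · rintro ⟨t, rfl⟩
    obtain ⟨r, hr⟩ := hmin.exists_smul_smul hA s a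
    exact ⟨t * r, by simp only [mul_smul, hr]⟩

/-- An extension of a regular polygon is obtained by adding disjoint copies of the orbit `Se`. -/
theorem HasMinimalCore.exists_decomposition (hmin : HasMinimalCore S) {e : S}
    (heR : e ∈ regularCore S) (he : IsIdempotentElem e) {A B : Type u} [MulAction S A]
    [MulAction S B] (hB : IsRegularPolygon S B) {f : A → B} (hf : Function.Injective f)
    (hs : ∀ (s : S) a, f (s • a) = s • f a) :
    ∃ (K : Type u) (θ : A ⊕ (Σ _ : K, MulAction.orbit S e) ≃ B), Cardinal.mk K ≤ Cardinal.mk B ∧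
      (∀ (s : S) x, θ (s • x) = s • θ x) ∧ ∀ a, θ (Sum.inl a) = f a := by
  -- Orbits are minimal, so one that meets the image of `A` lies inside it.
  have hrange : ∀ (s : S) {b : B}, b ∉ Set.range f → s • b ∉ Set.range f := by
    rintro s b hb ⟨a, ha⟩
    obtain ⟨t, ht⟩ := hmin.exists_smul_smul hB s b
    exact hb ⟨t • a, by rw [hs, ha, ht]⟩
  let K := {O : Set B // ∃ b ∉ Set.range f, O = MulAction.orbit S b}
  have hK : ∀ k : K, ∃ r ∉ Set.range f, e • r = r ∧ k.1 = MulAction.orbit S r := by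
    rintro ⟨-, b, hb, rfl⟩
    -- The orbit of `b` is also generated by `eb`, which `e` fixes. Hence every orbit is a copy of
    -- `Se`, whichever idempotent `e` of `R` was chosen.
    refine ⟨e • b, hrange e hb, ?_, (hmin.orbit_smul hB e b).symm⟩
    rw [smul_smul, he]
  choose r hr her hrk using hK
  have hann : ∀ k, leftAnn S (r k) = leftAnn S e := fun k => hmin.leftAnn_eq hB heR he (her k)
  let g : A ⊕ (Σ _ : K, MulAction.orbit S e) → B :=
    Sum.elim f fun x => (x.2 : S) • r x.1
  have hg : Function.Bijective g := by
    constructor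
    · rintro (a | ⟨k, l, s, rfl⟩) (a' | ⟨k', l', s', rfl⟩) h
      · exact congrArg Sum.inl (hf h)
      · exact (hrange _ (hr k') ⟨a, h⟩).elim
      · exact (hrange _ (hr k) ⟨a', h.symm⟩).elim
      · have hkk : k = k' := by
          refine Subtype.ext ?_
          rw [hrk, hrk, ← hmin.orbit_smul hB (s • e) (r k), ← hmin.orbit_smul hB (s' • e) (r k')]
          exact congrArg (MulAction.orbit S) h
        subst hkk
        have h' : (s • e) • r k = (s' • e) • r k := h
        have := (leftAnn_eq_iff.1 (hann k) _ _).1 h'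
        simp only [smul_eq_mul, mul_assoc] at this
        rw [he] at this
        simp only [smul_eq_mul, this]
    · intro b
      by_cases hb : b ∈ Set.range f
      · obtain ⟨a, rfl⟩ := hb
        exact ⟨Sum.inl a, rfl⟩
      · let k : K := ⟨_, b, hb, rfl⟩
        have hbk : b ∈ MulAction.orbit S (r k) := by
          rw [← hrk k]
          exact MulAction.mem_orbit_self b
        obtain ⟨s, hsb⟩ := hbk
        refine ⟨Sum.inr ⟨k, s • e, s, rfl⟩, ?_⟩
        change (s • e) • r k = b
        rw [smul_eq_mul, mul_smul, her]
        exact hsb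
  refine ⟨K, Equiv.ofBijective g hg, Cardinal.mk_le_of_injective (f := r) ?_, ?_, fun a => rfl⟩
  · intro k k' h
    refine Subtype.ext ?_
    rw [hrk, hrk, h]
  · rintro s (a | ⟨k, l⟩)
    · exact hs s a
    · exact mul_smul s (l : S) (r k)

theorem mk_eq_of_decomposition {A K L : Type u} {κ : Cardinal.{u}} (hκ : Cardinal.aleph0 ≤ κ)
    (hA : Cardinal.mk A < κ) (hL : Cardinal.mk L < κ) (hK : Cardinal.mk K ≤ κ)
    (h : Cardinal.mk (A ⊕ (Σ _ : K, L)) = κ) : Cardinal.mk K = κ := by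
  refine le_antisymm hK (le_of_not_gt fun hlt => ?_)
  refine absurd h (ne_of_lt ?_)
  rw [Cardinal.mk_sum, Cardinal.mk_sigma, Cardinal.sum_const]
  simp only [Cardinal.lift_id]
  exact Cardinal.add_lt_of_lt hκ hA (Cardinal.mul_lt_of_lt hκ hlt hL)

/-- Extensions of a regular polygon of the same sufficiently large cardinality are isomorphic over
it. -/
theorem HasMinimalCore.exists_equiv_over (hmin : HasMinimalCore S) {e : S}
    (heR : e ∈ regularCore S) (he : IsIdempotentElem e) {A B C : Type u} [MulAction S A]
    [MulAction S B] [MulAction S C] (hB : IsRegularPolygon S B) (hC : IsRegularPolygon S C)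
    (f : A ↪[polygonLanguage S] B) (g : A ↪[polygonLanguage S] C) {κ : Cardinal.{u}}
    (hκ : Cardinal.aleph0 ≤ κ) (hAκ : Cardinal.mk A < κ) (hSκ : Cardinal.mk S < κ)
    (hBκ : Cardinal.mk B = κ) (hCκ : Cardinal.mk C = κ) :
    ∃ h : B ≃[polygonLanguage S] C, ∀ a, h (f a) = g a := by
  obtain ⟨K, θ, hK, hθ, hθf⟩ := hmin.exists_decomposition heR he hB f.injective
    (polygonEmbedding_smul f)
  obtain ⟨K', θ', hK', hθ', hθg⟩ := hmin.exists_decomposition heR he hC g.injective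
    (polygonEmbedding_smul g)
  have hL : Cardinal.mk (MulAction.orbit S e) < κ := (Cardinal.mk_set_le _).trans_lt hSκ
  -- As `A` and `Se` are smaller than `κ`, exactly `κ` copies of `Se` are added in either extension.
  have h1 := mk_eq_of_decomposition hκ hAκ hL (hBκ ▸ hK) ((Cardinal.mk_congr θ).trans hBκ)
  have h2 := mk_eq_of_decomposition hκ hAκ hL (hCκ ▸ hK') ((Cardinal.mk_congr θ').trans hCκ)
  obtain ⟨σ⟩ := Cardinal.eq.1 (h1.trans h2.symm)
  let τ : A ⊕ (Σ _ : K, MulAction.orbit S e) ≃ A ⊕ (Σ _ : K', MulAction.orbit S e) :=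
    Equiv.sumCongr (Equiv.refl A) ((Equiv.sigmaEquivProd _ _).trans
      ((Equiv.prodCongr σ (Equiv.refl _)).trans (Equiv.sigmaEquivProd _ _).symm))
  have hτ : ∀ (s : S) x, τ (s • x) = s • τ x := by
    rintro s (a | ⟨k, l⟩) <;> rfl
  refine ⟨polygonEquiv ((θ.symm.trans τ).trans θ') fun s b => ?_, fun a => ?_⟩
  · obtain ⟨x, rfl⟩ := θ.surjective b
    rw [← hθ]
    simp only [Equiv.trans_apply, Equiv.symm_apply_apply]
    rw [hτ, hθ']
  · change θ' (τ (θ.symm (f a))) = g a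
    rw [← hθf, Equiv.symm_apply_apply, ← hθg]
    rfl

end Decomposition

/-! ### Model completeness -/

section ModelComplete

variable {S : Type u} [Monoid S]

/-- Infinite orbits make `A` and `B` infinite, so both have elementary extensions `A'` and `B'` of a
common large cardinality. These are isomorphic over `A`, whence truth at tuples of `A` agrees in `A`
and `B`. -/
theorem HasMinimalCore.realize_embedding (hmin : HasMinimalCore S)
    (hfin : (leftAnn S '' (regularCore S : Set S)).Finite)
    (hinf : ∀ a ∈ regularCore S, (MulAction.orbit S a).Infinite) {A B : Type u} [MulAction S A]
    [MulAction S B] [Nonempty A] (hA : IsRegularPolygon S A) (hB : IsRegularPolygon S B)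
    (f : A ↪[polygonLanguage S] B) {n : ℕ} (φ : (polygonLanguage S).Formula (Fin n))
    (x : Fin n → A) : φ.Realize (f ∘ x) ↔ φ.Realize x := by
  obtain ⟨a⟩ := ‹Nonempty A›
  obtain ⟨e, heR, he, hea⟩ := isRegularPolygon_iff.1 hA a
  have hAinf : Infinite A := by
    have := (hinf e heR).to_subtype
    refine Infinite.of_injective (fun l : MulAction.orbit S e => (l : S) • a) ?_
    rintro ⟨-, s, rfl⟩ ⟨-, t, rfl⟩ h
    have := (leftAnn_eq_iff.1 hea _ _).2 h
    simp only [smul_eq_mul, mul_assoc] at this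
    rw [he] at this
    simp only [smul_eq_mul, this]
  have hBinf : Infinite B := Infinite.of_injective f f.injective
  -- The successor of `μ` strictly exceeds `S`, `A` and `B`, as counting the added orbits requires,
  -- and bounds the language for Löwenheim–Skolem.
  let μ : Cardinal.{u} := max (max (Cardinal.mk S) (polygonLanguage S).card) (Cardinal.mk B)
  have hμκ : μ < Order.succ μ := Order.lt_succ μ
  have hBκ : Cardinal.mk B < Order.succ μ := (le_max_right _ _).trans_lt hμκ
  have hAκ : Cardinal.mk A < Order.succ μ :=
    (Cardinal.mk_le_of_injective f.injective).trans_lt hBκ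
  have hSκ : Cardinal.mk S < Order.succ μ :=
    ((le_max_left _ _).trans (le_max_left _ _)).trans_lt hμκ
  have hLκ : (polygonLanguage S).card ≤ Order.succ μ :=
    (((le_max_right _ _).trans (le_max_left _ _)).trans_lt hμκ).le
  have hκ : Cardinal.aleph0 ≤ Order.succ μ := (Cardinal.aleph0_le_mk B).trans hBκ.le
  have hax := isAxiomatizable_of_hasMinimalCore hmin hfin
  have ext : ∀ (D : Type u) [MulAction S D], IsRegularPolygon S D → Infinite D →
      Cardinal.mk D < Order.succ μ → ∃ (D' : Type u) (_ : MulAction S D'), IsRegularPolygon S D' ∧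
        Cardinal.mk D' = Order.succ μ ∧ Nonempty (D ↪ₑ[polygonLanguage S] D') := by
    intro D _ hD _ hDκ
    obtain ⟨N, ⟨j⟩, hN⟩ := Language.exists_elementaryEmbedding_card_eq_of_ge (polygonLanguage S) D
      (Order.succ μ) (by simpa using hLκ) (by simpa using hDκ.le)
    have hne : Nonempty N := Nonempty.map j inferInstance
    have hNT : N ⊨ classTheory (regularPolygons S) :=
      (j.theory_model_iff _).1 (model_classTheory (mem_regularPolygons hD))
    obtain ⟨D', act, -, hD', rfl⟩ :=
      exists_eq_of_mem_regularPolygons (hax.mem_regularPolygons hNT)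
    exact ⟨D', act, hD', hN, ⟨j⟩⟩
  obtain ⟨A', _, hA', hA'κ, ⟨i⟩⟩ := ext A hA hAinf hAκ
  obtain ⟨B', _, hB', hB'κ, ⟨j⟩⟩ := ext B hB hBinf hBκ
  obtain ⟨h, hh⟩ := hmin.exists_equiv_over heR he hA' hB' i.toEmbedding
    (j.toEmbedding.comp f) hκ hAκ hSκ hA'κ hB'κ
  rw [← j.map_formula, ← i.map_formula, ← Language.StrongHomClass.realize_formula h]
  refine iff_of_eq (congrArg φ.Realize (funext fun k => ?_))
  exact (hh (x k)).symm

theorem isModelCompleteClass_of_hasMinimalCore (hR : (regularCore S : Set S).Nonempty)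
    (hmin : HasMinimalCore S) (hfin : (leftAnn S '' (regularCore S : Set S)).Finite)
    (hinf : ∀ a ∈ regularCore S, (MulAction.orbit S a).Infinite) :
    IsModelCompleteClass (regularPolygons S) := by
  have hax := isAxiomatizable_of_hasMinimalCore hmin hfin
  constructor
  · obtain ⟨M, hM⟩ := regularPolygons_nonempty hR
    have := hM.1
    have := model_classTheory hM
    exact Language.Theory.Model.isSatisfiable M
  · intro M str hne hM N hneN hN
    have key : ∀ M N : Bundled.{u} (polygonLanguage S).Structure, M ∈ regularPolygons S →
        N ∈ regularPolygons S → ∀ (f : N ↪[polygonLanguage S] M) (n : ℕ)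
        (φ : (polygonLanguage S).Formula (Fin n)) (x : Fin n → N),
        φ.Realize (f ∘ x) ↔ φ.Realize x := by
      intro M N hM hN f n φ x
      obtain ⟨A, _, _, hA, rfl⟩ := exists_eq_of_mem_regularPolygons hN
      obtain ⟨B, _, _, hB, rfl⟩ := exists_eq_of_mem_regularPolygons hM
      exact hmin.realize_embedding hfin hinf hA hB f φ x
    intro n φ x
    exact key ⟨M, str⟩ ⟨N, inferInstance⟩ (hax.mem_regularPolygons (hne := hne) hM)
      (hax.mem_regularPolygons (hne := hneN) hN) N.subtype n φ x

end ModelComplete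

end RegularPolygons

open RegularPolygons in
theorem theorem6p1 (S : Type u) [Monoid S] (hR : (regularCore S : Set S).Nonempty) :
    List.TFAE
      [IsAxiomatizable (regularPolygons S) ∧ IsModelCompleteClass (regularPolygons S) ∧
          HasFormulaDefinableIsomorphicOrbits S,
        IsAxiomatizable (regularPolygons S) ∧ IsCompleteClass (regularPolygons S) ∧
          HasFormulaDefinableIsomorphicOrbits S,
        ∃ D : RectangularBandOfGroups (regularCore S),
          (∀ i j, (D.component i j).Infinite) ∧ Finite D.I] := by
  tfae_have 1 → 2
  | ⟨hax, hmc, hdef⟩ => ⟨hax, isCompleteClass_of_modelComplete hR hmc, hdef⟩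
  tfae_have 2 → 3
  | ⟨hax, hK, hdef⟩ => by
    have hmin := hasMinimalCore_of_complete hK hdef
    have hfin := finite_leftAnn_of_axiomatizable hax hdef
    refine ⟨hmin.band, hmin.infinite_band_component hfin fun a ha =>
      infinite_orbit_of_complete hK ha, (hfin.subset ?_).to_subtype⟩
    rintro - ⟨a, rfl⟩
    exact ⟨a, a.2, rfl⟩
  tfae_have 3 → 1
  | ⟨D, hD, _⟩ =>
    have hmin := RectangularBandOfGroups.hasMinimalCore D
    have hfin := RectangularBandOfGroups.finite_leftAnn D
    ⟨isAxiomatizable_of_hasMinimalCore hmin hfin,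
      isModelCompleteClass_of_hasMinimalCore hR hmin hfin fun _ ha =>
        RectangularBandOfGroups.infinite_orbit D hD ha,
      hasFormulaDefinableIsomorphicOrbits_of_hasMinimalCore hmin⟩
  tfae_finish
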